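/- Let $n\le 3$ and let $K\subset\mathbb{R}^n$ be a convex body, that is, a compact convex set with nonempty interior. Let $T$ be a proper tiling of $K$: a finite set of convex bodies (the tiles), containing more than one tile, whose union is $K$ and whose interiors are pairwise disjoint. Suppose that at least $n-1$ of the tiles in $T$ are similar to $K$, where a tile $L$ is similar to $K$ if $L=f(K)$ for some similarity $f$ of $\mathbb{R}^n$ (a bijection of $\mathbb{R}^n$ multiplying all Euclidean distances by a fixed positive constant). Then $K$ is a polytope, i.e. the convex hull of finitely many points (so a convex polygon if $n=2$ and a convex polyhedron if $n=3$). In particular, a convex body in $\mathbb{R}^3$ that has a proper finite tiling with two tiles similar to it is a convex polyhedron, which answers a question of Zamfirescu. -/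

import Mathlib

/-- A convex body: a compact convex set with nonempty interior. -/
structure IsConvexBody {E : Type*} [NormedAddCommGroup E] [NormedSpace ℝ E]
    (K : Set E) : Prop where
  isCompact : IsCompact K
  convex : Convex ℝ K
  interior_nonempty : (interior K).Nonempty

/-- `T` is a tiling of `K`: a finite set of convex bodies (the tiles) whose union is `K` and
whose interiors are pairwise disjoint. -/
structure IsTiling {E : Type*} [NormedAddCommGroup E] [NormedSpace ℝ E]
    (K : Set E) (T : Set (Set E)) : Prop where
  finite : T.Finite
  isConvexBody : ∀ P ∈ T, IsConvexBody P
  sUnion_eq : ⋃₀ T = K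
  disjoint_interior : ∀ P ∈ T, ∀ Q ∈ T, P ≠ Q → Disjoint (interior P) (interior Q)

/-- A proper tiling: one that consists of more than one tile. -/
structure IsProperTiling {E : Type*} [NormedAddCommGroup E] [NormedSpace ℝ E]
    (K : Set E) (T : Set (Set E)) : Prop extends IsTiling K T where
  nontrivial : T.Nontrivial

/-- `L` is similar to `K`: some similarity of the ambient space (a bijection that multiplies all
distances by one positive constant) maps `K` onto `L`. -/
def IsSimilarTo {E : Type*} [NormedAddCommGroup E] [NormedSpace ℝ E]
    (L K : Set E) : Prop :=
  ∃ f : E ≃ᵈ E, f '' K = L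

/-- A polytope: the convex hull of finitely many points. -/
def IsPolytope {E : Type*} [NormedAddCommGroup E] [NormedSpace ℝ E]
    (K : Set E) : Prop :=
  ∃ s : Set E, s.Finite ∧ convexHull ℝ s = K

/-! Separating hyperplanes exhibit each tile as `K` cut by finitely many half-spaces, and a tile `f
'' K` different from `K` forces the similarity `f` to be a contraction. Call a point of `K` singular
if `K` is not polyhedral near it. Singular points form a closed set that `f` maps into itself, so if
there are any, the fixed point `p` of `f` is one. Powers of the isometric linear part of `f` bring
any given vector back close to itself; hence `f '' K` and `K` agree near `p`
(`IsCut.eventually_mem_image`), and `K` is a cone near `p` (`IsCut.isConicalAt`). The dual of this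
cone has a compact convex slice of dimension at most `n - 1`. For `n = 2` the slice is a segment or
empty, so finitely many half-spaces define the cone: a contradiction.

For `n = 3` let `g '' K` be a second similar tile. Then `f ^ k * g` is again a contraction onto a
piece cut from `K`, so it has a singular fixed point `x`. It differs from `p`, and for large `k` it
lies where `K` is a cone with apex `p`. So `x` is inside a segment of `K` along the ray from `p`;
this lowers the dimension of the dual slice at `x` to at most one, again a contradiction.

Without singular points, compactness leaves finitely many extreme points, and Krein–Milman
concludes. -/

open Filter Topology Metric Set

/-! ### Local polyhedrality, and tiles as polyhedral cuts -/

section Polyhedron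

variable {E : Type*} [NormedAddCommGroup E] [NormedSpace ℝ E]

/-- A polyhedron: the intersection of finitely many closed half-spaces. -/
def IsPolyhedron (P : Set E) : Prop :=
  ∃ F : Set ((E →L[ℝ] ℝ) × ℝ), F.Finite ∧ P = {y | ∀ h ∈ F, h.1 y ≤ h.2}

theorem IsPolyhedron.inter {P Q : Set E} (hP : IsPolyhedron P) (hQ : IsPolyhedron Q) :
    IsPolyhedron (P ∩ Q) := by
  obtain ⟨F, hF, rfl⟩ := hP
  obtain ⟨G, hG, rfl⟩ := hQ
  refine ⟨F ∪ G, hF.union hG, ?_⟩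
  ext y
  simp only [mem_inter_iff, mem_ofPred_eq, mem_union, or_imp, forall_and]

theorem isPolyhedron_univ : IsPolyhedron (univ : Set E) :=
  ⟨∅, finite_empty, by simp⟩

/-- `K` coincides with a polyhedron in a neighbourhood of `x`. -/
def IsLocallyPolyhedralAt (K : Set E) (x : E) : Prop :=
  ∃ P, IsPolyhedron P ∧ ∀ᶠ y in 𝓝 x, y ∈ K ↔ y ∈ P

theorem IsLocallyPolyhedralAt.eventually {K : Set E} {x : E} (h : IsLocallyPolyhedralAt K x) :
    ∀ᶠ y in 𝓝 x, IsLocallyPolyhedralAt K y := by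
  obtain ⟨P, hP, h⟩ := h
  filter_upwards [eventually_eventually_nhds.2 h] with y hy using ⟨P, hP, hy⟩

theorem IsLocallyPolyhedralAt.inter {K P : Set E} {x : E} (h : IsLocallyPolyhedralAt K x)
    (hP : IsPolyhedron P) : IsLocallyPolyhedralAt (K ∩ P) x := by
  obtain ⟨Q, hQ, h⟩ := h
  refine ⟨Q ∩ P, hQ.inter hP, ?_⟩
  filter_upwards [h] with y hy
  simp [hy]

/-- A set that coincides with a polyhedron near `x` has finitely many extreme points near `x`. -/
theorem IsLocallyPolyhedralAt.exists_finite_extremePoints {K : Set E} {x : E}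
    (h : IsLocallyPolyhedralAt K x) : ∃ U ∈ 𝓝 x, (U ∩ K.extremePoints ℝ).Finite := by
  obtain ⟨P, ⟨F, hF, rfl⟩, h⟩ := h
  obtain ⟨U, hU, hUo, hxU⟩ := _root_.eventually_nhds_iff.1 h
  refine ⟨U, hUo.mem_nhds hxU, ?_⟩
  -- An extreme point near `x` is determined by its set of active constraints: if `y` and `z` share
  -- it, then `y` can be pushed slightly away from `z` within `K`, so `y` lies between two points of
  -- `K`.
  refine Finite.of_finite_image (f := fun y => {h ∈ F | h.1 y = h.2})
    ((hF.finite_subsets).subset ?_) ?_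
  · rintro _ ⟨y, -, rfl⟩
    exact sep_subset _ _
  rintro y ⟨hyU, hy⟩ z ⟨hzU, hz⟩ hyz
  have hyP := (hU y hyU).1 hy.1
  have hzP := (hU z hzU).1 hz.1
  have hline : Tendsto (fun t : ℝ => y + t • (y - z)) (𝓝[>] 0) (𝓝 y) := by
    have : Continuous (fun t : ℝ => y + t • (y - z)) := by fun_prop
    simpa using (this.tendsto 0).mono_left nhdsWithin_le_nhds
  have hev : ∀ᶠ t : ℝ in 𝓝[>] 0, y + t • (y - z) ∈ K := by
    have h1 : ∀ᶠ t : ℝ in 𝓝[>] 0, ∀ h ∈ F, h.1 (y + t • (y - z)) ≤ h.2 := by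
      refine (hF.eventually_all).2 fun h hh => ?_
      by_cases hact : h.1 y = h.2
      · have hz' : h.1 z = h.2 := by
          have : h ∈ {h ∈ F | h.1 y = h.2} := ⟨hh, hact⟩
          exact ((Set.ext_iff.1 hyz h).1 this).2
        exact Eventually.of_forall fun t => by simp [hact, hz']
      · have hlt : h.1 y < h.2 := lt_of_le_of_ne (hyP h hh) hact
        have := (h.1.continuous.tendsto y).comp hline
        exact (this.eventually (gt_mem_nhds hlt)).mono fun t ht => le_of_lt ht
    filter_upwards [h1, hline.eventually (hUo.mem_nhds hyU)] with t ht htU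
    exact (hU _ htU).2 ht
  obtain ⟨t, htK, ht⟩ := (hev.and self_mem_nhdsWithin).exists
  have ht : 0 < t := ht
  refine ((mem_extremePoints.1 hy).2 _ htK z hz.1 ⟨1 / (1 + t), t / (1 + t), by positivity,
    by positivity, by field_simp, ?_⟩).2.symm
  have h1 : (1 / (1 + t)) • (y + t • (y - z)) + (t / (1 + t)) • z
      = ((1 / (1 + t)) * (1 + t)) • y := by
    module
  rw [h1, one_div, inv_mul_cancel₀ (by positivity), one_smul]

/-- A compact convex set that is locally polyhedral is a polytope. -/
theorem isPolytope_of_isLocallyPolyhedralAt {K : Set E} (hK : IsCompact K) (hc : Convex ℝ K)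
    (h : ∀ x ∈ K, IsLocallyPolyhedralAt K x) : IsPolytope K := by
  have hfin : (K ∩ K.extremePoints ℝ).Finite := by
    refine hK.induction_on (p := fun s => (s ∩ K.extremePoints ℝ).Finite) (by simp) ?_ ?_ ?_
    · exact fun s t hst ht => ht.subset (inter_subset_inter_left _ hst)
    · intro s t hs ht
      rw [union_inter_distrib_right]
      exact hs.union ht
    · intro x hx
      obtain ⟨U, hU, hfin⟩ := (h x hx).exists_finite_extremePoints
      exact ⟨U, mem_nhdsWithin_of_mem_nhds hU, hfin⟩
  rw [inter_eq_self_of_subset_right extremePoints_subset] at hfin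
  refine ⟨_, hfin, ?_⟩
  rw [← (hfin.isCompact_convexHull ℝ).isClosed.closure_eq]
  exact closure_convexHull_extremePoints hK hc

/-- `L` is cut out of `K` by finitely many closed half-spaces. -/
def IsCut (L K : Set E) : Prop :=
  ∃ P, IsPolyhedron P ∧ L = K ∩ P

theorem IsCut.refl (K : Set E) : IsCut K K :=
  ⟨univ, isPolyhedron_univ, by simp⟩

theorem IsCut.subset {L K : Set E} (h : IsCut L K) : L ⊆ K := by
  obtain ⟨P, -, rfl⟩ := h
  exact inter_subset_left

theorem IsCut.trans {L M K : Set E} (h : IsCut L M) (h' : IsCut M K) : IsCut L K := by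
  obtain ⟨P, hP, rfl⟩ := h
  obtain ⟨Q, hQ, rfl⟩ := h'
  exact ⟨Q ∩ P, hQ.inter hP, inter_assoc _ _ _⟩

/-- Hahn–Banach separates the open interiors, and a convex body lies in the closure of its interior.
Strictness on `interior L` is kept for `IsTiling.isCut`. -/
theorem exists_halfSpace_of_disjoint_interior {L Q : Set E} (hL : IsConvexBody L)
    (hQ : IsConvexBody Q) (h : Disjoint (interior L) (interior Q)) :
    ∃ (φ : E →L[ℝ] ℝ) (c : ℝ), (∀ y ∈ L, φ y ≤ c) ∧ (∀ y ∈ interior L, φ y < c) ∧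
      ∀ y ∈ Q, c ≤ φ y := by
  obtain ⟨φ, c, h1, h2⟩ := geometric_hahn_banach_open_open hL.convex.interior isOpen_interior
    hQ.convex.interior isOpen_interior h
  have key : ∀ {M : Set E}, IsConvexBody M → M ⊆ closure (interior M) := fun hM => by
    rw [hM.convex.closure_interior_eq_closure_of_nonempty_interior hM.interior_nonempty]
    exact subset_closure
  refine ⟨φ, c, fun y hy => ?_, h1, fun y hy => ?_⟩
  · exact closure_minimal (fun z hz => (h1 z hz).le) (isClosed_le φ.continuous continuous_const)
      (key hL hy)
  · exact closure_minimal (fun z hz => (h2 z hz).le) (isClosed_le continuous_const φ.continuous)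
      (key hQ hy)

/-- Every tile of a tiling of `K` is cut out of `K` by finitely many half-spaces. -/
theorem IsTiling.isCut {K : Set E} {T : Set (Set E)} (hT : IsTiling K T) (hK : Convex ℝ K)
    {L : Set E} (hL : L ∈ T) : IsCut L K := by
  have hbody := hT.isConvexBody L hL
  have hex : ∀ Q : Set E, ∃ h : (E →L[ℝ] ℝ) × ℝ, Q ∈ T \ {L} → (∀ y ∈ L, h.1 y ≤ h.2) ∧
      (∀ y ∈ interior L, h.1 y < h.2) ∧ ∀ y ∈ Q, h.2 ≤ h.1 y := by
    intro Q
    by_cases hQ : Q ∈ T \ {L}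
    · obtain ⟨φ, c, h⟩ := exists_halfSpace_of_disjoint_interior hbody (hT.isConvexBody Q hQ.1)
        (hT.disjoint_interior L hL Q hQ.1 (Ne.symm hQ.2))
      exact ⟨(φ, c), fun _ => h⟩
    · exact ⟨0, fun h => absurd h hQ⟩
  choose H hH using hex
  refine ⟨_, ⟨H '' (T \ {L}), (hT.finite.sdiff).image _, rfl⟩, ?_⟩
  have hLK : L ⊆ K := hT.sUnion_eq ▸ subset_sUnion_of_mem hL
  refine Subset.antisymm (fun y hy => ⟨hLK hy, ?_⟩) ?_
  · rintro _ ⟨Q, hQ, rfl⟩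
    exact (hH Q hQ).1 y hy
  rintro x ⟨hxK, hx⟩
  -- Points moved from `x` slightly towards an interior point `y` of `L` satisfy all separating
  -- inequalities strictly, so no other tile contains them; they lie in `L` and tend to `x`.
  obtain ⟨y, hy⟩ := hbody.interior_nonempty
  have hcont : Tendsto (fun t : ℝ => (1 - t) • x + t • y) (𝓝[>] 0) (𝓝 x) := by
    have : Continuous (fun t : ℝ => (1 - t) • x + t • y) := by fun_prop
    simpa using (this.tendsto 0).mono_left nhdsWithin_le_nhds
  refine hbody.isCompact.isClosed.mem_of_tendsto hcont ?_
  filter_upwards [Ioo_mem_nhdsGT (zero_lt_one : (0 : ℝ) < 1)] with t ht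
  have hzK : (1 - t) • x + t • y ∈ K :=
    hK hxK (hLK (interior_subset hy)) (by linarith [ht.2]) ht.1.le (by ring)
  rw [← hT.sUnion_eq] at hzK
  obtain ⟨Q, hQ, hzQ⟩ := hzK
  by_cases hQL : Q = L
  · exact hQL ▸ hzQ
  exfalso
  obtain ⟨-, h2, h3⟩ := hH Q ⟨hQ, hQL⟩
  have h4 := h3 _ hzQ
  have h5 := h2 y hy
  have h6 := hx _ ⟨Q, ⟨hQ, hQL⟩, rfl⟩
  simp only [map_add, map_smul, smul_eq_mul] at h4
  nlinarith [ht.1, ht.2]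

/-- In a proper tiling of `K`, no tile is `K` itself. -/
theorem IsProperTiling.ne {K : Set E} {T : Set (Set E)} (hT : IsProperTiling K T)
    {L : Set E} (hL : L ∈ T) : L ≠ K := by
  rintro rfl
  obtain ⟨Q, hQ, hQL⟩ := hT.nontrivial.exists_ne L
  obtain ⟨x, hx⟩ := (hT.isConvexBody Q hQ).interior_nonempty
  have hsub : Q ⊆ L := hT.sUnion_eq ▸ subset_sUnion_of_mem hQ
  exact (hT.disjoint_interior Q hQ L hL hQL).le_bot ⟨hx, interior_mono hsub hx⟩

end Polyhedron

/-! ### Recurrence of non-contracting self-maps -/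

section Recurrence

variable {X : Type*} [PseudoMetricSpace X]

theorem dist_le_dist_iterate {f : X → X} {K : Set X} (hf : MapsTo f K K)
    (hd : ∀ a ∈ K, ∀ b ∈ K, dist a b ≤ dist (f a) (f b)) (n : ℕ) {a b : X} (ha : a ∈ K)
    (hb : b ∈ K) : dist a b ≤ dist (f^[n] a) (f^[n] b) := by
  induction n generalizing a b with
  | zero => exact le_rfl
  | succ n ih => exact (hd a ha b hb).trans (ih (hf ha) (hf hb))

/-- Every point of a compact set is recurrent for a self-map that does not decrease distances. -/
theorem IsCompact.exists_dist_iterate_lt {f : X → X} {K : Set X} (hK : IsCompact K)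
    (hf : MapsTo f K K) (hd : ∀ a ∈ K, ∀ b ∈ K, dist a b ≤ dist (f a) (f b)) {x : X} (hx : x ∈ K)
    {ε : ℝ} (hε : 0 < ε) : ∃ k, 1 ≤ k ∧ dist (f^[k] x) x < ε := by
  -- Two close orbit points at times `φ N < φ (N + 1)` can be moved back by `φ N` steps without
  -- increasing their distance.
  obtain ⟨a, -, φ, hφ, hlim⟩ := hK.tendsto_subseq fun n => hf.iterate n hx
  obtain ⟨N, hN⟩ := Metric.cauchySeq_iff.1 hlim.cauchySeq ε hε
  have h := hN (N + 1) (by omega) N le_rfl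
  have hlt : φ N < φ (N + 1) := hφ (by omega)
  refine ⟨φ (N + 1) - φ N, by omega, lt_of_le_of_lt ?_ h⟩
  refine (dist_le_dist_iterate hf hd (φ N) (hf.iterate _ hx) hx).trans (le_of_eq ?_)
  rw [← Function.iterate_add_apply]
  simp only [Function.comp_apply]
  congr 2
  omega

/-- A self-map of a compact set onto a closed set that does not decrease distances is onto. -/
theorem IsCompact.image_eq_of_dist_le {f : X → X} {K : Set X} (hK : IsCompact K)
    (hf : MapsTo f K K) (hd : ∀ a ∈ K, ∀ b ∈ K, dist a b ≤ dist (f a) (f b))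
    (hcl : IsClosed (f '' K)) : f '' K = K := by
  refine Subset.antisymm hf.image_subset fun x hx => ?_
  rw [← hcl.closure_eq, Metric.mem_closure_iff]
  intro ε hε
  obtain ⟨k, hk, h⟩ := hK.exists_dist_iterate_lt hf hd hx hε
  obtain ⟨j, rfl⟩ := Nat.exists_eq_add_of_le' hk
  refine ⟨_, ⟨f^[j] x, hf.iterate j hx, rfl⟩, ?_⟩
  rw [← Function.iterate_succ_apply' f, dist_comm]
  exact h

end Recurrence

/-! ### Similarities onto proper subsets -/

section Contraction

variable {X : Type*} [MetricSpace X]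

theorem DilationEquiv.contractingWith {f : X ≃ᵈ X} (hf : Dilation.ratio f < 1) :
    ContractingWith (Dilation.ratio f) f :=
  ⟨hf, Dilation.lipschitz f⟩

/-- A similarity that maps a compact set onto a proper subset of it is a contraction. -/
theorem IsCompact.ratio_lt_one {K : Set X} (hK : IsCompact K) {f : X ≃ᵈ X} (hf : f '' K ⊆ K)
    (hne : f '' K ≠ K) : Dilation.ratio f < 1 := by
  by_contra! h
  refine hne (hK.image_eq_of_dist_le (mapsTo_iff_image_subset.2 hf) (fun a _ b _ => ?_)
    (hK.image (Dilation.lipschitz f).continuous).isClosed)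
  rw [Dilation.dist_eq]
  exact le_mul_of_one_le_left dist_nonneg (by exact_mod_cast h)

end Contraction

/-! ### Singular fixed points and conicality -/

section Similarity

variable {E : Type*} [NormedAddCommGroup E] [NormedSpace ℝ E]

/-- A similarity is affine, and its linear part is a multiple of a linear isometry. -/
theorem DilationEquiv.exists_linearIsometryEquiv (f : E ≃ᵈ E) :
    ∃ A : E ≃ₗᵢ[ℝ] E, ∀ p v, f (p + v) = f p + (Dilation.ratio f : ℝ) • A v := by
  have hr : (Dilation.ratio f : ℝ) ≠ 0 := by exact_mod_cast Dilation.ratio_ne_zero f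
  -- Normalised to fix `0` and have ratio one, `f` becomes an isometry, linear by Mazur–Ulam.
  let g : E ≃ᵢ E := IsometryEquiv.mk'
    (fun v => (Dilation.ratio f : ℝ)⁻¹ • (f v - f 0))
    (fun w => f.symm (f 0 + (Dilation.ratio f : ℝ) • w))
    (fun w => by simp [smul_smul, inv_mul_cancel₀ hr])
    (Isometry.of_dist_eq fun a b => by
      rw [dist_smul₀, dist_sub_right, Dilation.dist_eq, norm_inv, Real.norm_eq_abs, NNReal.abs_eq,
        inv_mul_cancel_left₀ hr])
  have hg : ∀ v, f v = f 0 + (Dilation.ratio f : ℝ) • g v := fun v => by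
    change f v = f 0 + (Dilation.ratio f : ℝ) • ((Dilation.ratio f : ℝ)⁻¹ • (f v - f 0))
    rw [smul_smul, mul_inv_cancel₀ hr, one_smul, add_sub_cancel]
  have hg0 : g 0 = 0 := by
    change (Dilation.ratio f : ℝ)⁻¹ • (f 0 - f 0) = 0
    simp
  refine ⟨g.toRealLinearIsometryEquivOfMapZero hg0, fun p v => ?_⟩
  have h1 : f (p + v) = f 0 + (Dilation.ratio f : ℝ) •
      g.toRealLinearIsometryEquivOfMapZero hg0 (p + v) := hg _
  have h2 : f p = f 0 + (Dilation.ratio f : ℝ) • g.toRealLinearIsometryEquivOfMapZero hg0 p := hg p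
  rw [h1, h2, map_add, smul_add, add_assoc]

theorem IsPolyhedron.image {P : Set E} (hP : IsPolyhedron P) (f : E ≃ᵈ E) :
    IsPolyhedron (f '' P) := by
  obtain ⟨F, hF, rfl⟩ := hP
  obtain ⟨A, hA⟩ := f.symm.exists_linearIsometryEquiv
  have key : ∀ y, f.symm y = f.symm 0 + (Dilation.ratio f.symm : ℝ) • A y := fun y => by
    simpa using hA 0 y
  refine ⟨(fun h : (E →L[ℝ] ℝ) × ℝ => ((Dilation.ratio f.symm : ℝ) •
    h.1.comp (A : E →L[ℝ] E), h.2 - h.1 (f.symm 0))) '' F, hF.image _, ?_⟩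
  ext y
  have : y ∈ f '' {y | ∀ h ∈ F, h.1 y ≤ h.2} ↔ ∀ h ∈ F, h.1 (f.symm y) ≤ h.2 := by
    constructor
    · rintro ⟨x, hx, rfl⟩
      simpa using hx
    · exact fun h => ⟨f.symm y, h, f.apply_symm_apply y⟩
  rw [this, mem_ofPred_eq, forall_mem_image]
  refine forall₂_congr fun h _ => ?_
  rw [key, map_add, map_smul, le_sub_iff_add_le']
  rfl

theorem IsCut.image {L K : Set E} (h : IsCut L K) (f : E ≃ᵈ E) : IsCut (f '' L) (f '' K) := by
  obtain ⟨P, hP, rfl⟩ := h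
  exact ⟨f '' P, hP.image f, image_inter f.injective⟩

theorem IsCut.iterate_image {K : Set E} {f : E ≃ᵈ E} (h : IsCut (f '' K) K) (k : ℕ) :
    IsCut ((f ^ k : E ≃ᵈ E) '' K) K := by
  induction k with
  | zero => simpa using IsCut.refl K
  | succ k ih =>
    rw [pow_succ, DilationEquiv.coe_mul, image_comp]
    exact (h.image _).trans ih

theorem IsLocallyPolyhedralAt.image {K : Set E} {x : E} (h : IsLocallyPolyhedralAt K x)
    (f : E ≃ᵈ E) : IsLocallyPolyhedralAt (f '' K) (f x) := by
  obtain ⟨P, hP, h⟩ := h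
  refine ⟨f '' P, hP.image f, ?_⟩
  have hmap : map f (𝓝 x) = 𝓝 (f x) := f.toHomeomorph.map_nhds_eq x
  rw [← hmap, eventually_map]
  filter_upwards [h] with y hy
  rw [f.injective.mem_set_image, f.injective.mem_set_image, hy]

/-- If a smaller similar copy `f '' K` is cut out of `K` by half-spaces, and `K` is not locally
polyhedral everywhere, then it is not locally polyhedral at the fixed point of `f`. -/
theorem exists_fixedPoint_not_isLocallyPolyhedralAt [CompleteSpace E] {K : Set E}
    (hK : IsClosed K) {f : E ≃ᵈ E} (hf : Dilation.ratio f < 1) (hcut : IsCut (f '' K) K)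
    (hS : ∃ x ∈ K, ¬ IsLocallyPolyhedralAt K x) :
    ∃ p ∈ K, ¬ IsLocallyPolyhedralAt K p ∧ f p = p := by
  set S : Set E := {x ∈ K | ¬ IsLocallyPolyhedralAt K x} with hSdef
  have hSc : IsClosed S := by
    have hopen : IsOpen {x | IsLocallyPolyhedralAt K x} :=
      isOpen_iff_mem_nhds.2 fun x hx => IsLocallyPolyhedralAt.eventually hx
    exact hK.inter hopen.isClosed_compl
  have hmaps : MapsTo f S S := by
    rintro x ⟨hxK, hx⟩
    refine ⟨hcut.subset ⟨x, hxK, rfl⟩, fun hfx => hx ?_⟩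
    obtain ⟨P, hP, hPK⟩ := hcut
    have h1 : IsLocallyPolyhedralAt (f '' K) (f x) := hPK ▸ hfx.inter hP
    have h2 := h1.image f.symm
    rwa [← image_comp, f.symm_apply_apply, show (f.symm ∘ f : E → E) = id from
      funext f.symm_apply_apply, image_id] at h2
  obtain ⟨x, hx⟩ := hS
  have hc := DilationEquiv.contractingWith hf
  have hmem := hSc.mem_of_tendsto (hc.tendsto_iterate_fixedPoint x)
    (Eventually.of_forall fun n => hmaps.iterate n hx)
  exact ⟨_, hmem.1, hmem.2, hc.fixedPoint_isFixedPt⟩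

/-- A linear isometry of a finite-dimensional space is recurrent. -/
theorem LinearIsometryEquiv.exists_norm_iterate_sub_lt [FiniteDimensional ℝ E] (A : E ≃ₗᵢ[ℝ] E)
    (x : E) (N : ℕ) {ε : ℝ} (hε : 0 < ε) : ∃ k, N ≤ k ∧ dist (A^[k] x) x < ε := by
  have : ProperSpace E := FiniteDimensional.proper_real E
  have hmaps : MapsTo A (closedBall 0 ‖x‖) (closedBall 0 ‖x‖) := fun y hy => by simpa using hy
  -- Recurrence is applied to `A^[N]`, so that the return time is a multiple of `N`.
  obtain ⟨k, hk, h⟩ := (isCompact_closedBall (0 : E) ‖x‖).exists_dist_iterate_lt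
    (hmaps.iterate N)
    (fun a ha b hb => dist_le_dist_iterate hmaps (fun a _ b _ => (A.dist_map a b).ge) N ha hb)
    (x := x) (by simp) hε
  rw [← Function.iterate_mul] at h
  exact ⟨N * k, Nat.le_mul_of_pos_right N hk, h⟩

/-- `K` coincides near `p` with a cone with apex `p`. -/
def IsConicalAt (K : Set E) (p : E) : Prop :=
  ∃ r > 0, ∀ v, p + v ∈ K → ∀ c : ℝ, 0 ≤ c → ‖c • v‖ < r → p + c • v ∈ K

variable [FiniteDimensional ℝ E] {K : Set E} {f : E ≃ᵈ E} {p : E}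

/-- If `f '' K` is cut out of `K` by half-spaces and `f` fixes `p`, then `f '' K` and `K` coincide
near `p`. -/
theorem IsCut.eventually_mem_image (hcut : IsCut (f '' K) K) (hp : p ∈ K) (hfp : f p = p) :
    ∀ᶠ y in 𝓝 p, y ∈ K → y ∈ f '' K := by
  have hsub := hcut.subset
  obtain ⟨_, ⟨F, hF, rfl⟩, hPK⟩ := hcut
  obtain ⟨A, hA⟩ := f.exists_linearIsometryEquiv
  have hr : (0 : ℝ) < Dilation.ratio f := by exact_mod_cast Dilation.ratio_pos f
  have hmaps : MapsTo f K K := mapsTo_iff_image_subset.2 hsub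
  have hF' : ∀ y ∈ f '' K, ∀ h ∈ F, h.1 y ≤ h.2 := fun y hy => (hPK ▸ hy).2
  have hiter : ∀ (v : E) (k : ℕ), f^[k] (p + v) = p + (Dilation.ratio f : ℝ) ^ k • A^[k] v := by
    intro v k
    induction k with
    | zero => simp
    | succ k ih =>
      rw [Function.iterate_succ_apply', ih, hA, hfp, Function.iterate_succ_apply', map_smul,
        smul_smul, pow_succ']
  have hev : ∀ᶠ y in 𝓝 p, ∀ h ∈ F, y ∈ K → h.1 y ≤ h.2 := by
    refine hF.eventually_all.2 fun h hh => ?_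
    have hle : h.1 p ≤ h.2 := hF' p ⟨p, hp, hfp⟩ h hh
    rcases hle.lt_or_eq with hlt | heq
    · exact ((h.1.continuous.tendsto p).eventually (gt_mem_nhds hlt)).mono fun y hy _ => hy.le
    -- A half-space with `p` on its boundary contains all of `K`: if `y` violated it, so would
    -- `f^[k] y` for some `k ≥ 1` at which the linear part returns `y - p` near itself, yet that
    -- point is in `f '' K`.
    refine Eventually.of_forall fun y hy => ?_
    by_contra! hgt
    have hpos : 0 < h.1 (y - p) := by rw [map_sub]; linarith
    obtain ⟨δ, hδ, hball⟩ := Metric.eventually_nhds_iff.1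
      ((h.1.continuous.tendsto (y - p)).eventually (lt_mem_nhds hpos))
    obtain ⟨k, hk, hdist⟩ := A.exists_norm_iterate_sub_lt (y - p) 1 hδ
    have h1 := hball hdist
    obtain ⟨j, rfl⟩ := Nat.exists_eq_add_of_le' hk
    have h2 := hF' (f^[j + 1] (p + (y - p))) (by
      rw [Function.iterate_succ_apply']
      exact ⟨_, hmaps.iterate j (by simpa using hy), rfl⟩) h hh
    rw [hiter, map_add, map_smul, smul_eq_mul] at h2
    have := mul_pos (pow_pos hr (j + 1)) h1
    linarith
  filter_upwards [hev] with y hy hyK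
  rw [hPK]
  exact ⟨hyK, fun h hh => hy h hh hyK⟩

/-- Near `p`, points of `K` can be pulled back by `f` within `K`. For large `k`, convexity puts `p +
l ^ k • c • v` in `K`; pulling back `k` times gives `p + A.symm^[k] (c • v)`, which recurrence
brings arbitrarily close to `p + c • v`. -/
theorem IsCut.isConicalAt (hcut : IsCut (f '' K) K) (hK : IsClosed K) (hc : Convex ℝ K)
    (hf : Dilation.ratio f < 1) (hp : p ∈ K) (hfp : f p = p) : IsConicalAt K p := by
  obtain ⟨r, hr, hball⟩ := Metric.eventually_nhds_iff.1 (hcut.eventually_mem_image hp hfp)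
  obtain ⟨A, hA⟩ := f.exists_linearIsometryEquiv
  set l : ℝ := (Dilation.ratio f : ℝ) with hl
  have hl0 : 0 < l := by rw [hl]; exact_mod_cast Dilation.ratio_pos f
  have hl1 : l < 1 := by rw [hl]; exact_mod_cast hf
  have hexp : ∀ (k : ℕ) (u : E), ‖u‖ < r → p + l ^ k • u ∈ K → p + A.symm^[k] u ∈ K := by
    intro k
    induction k with
    | zero => simp
    | succ k ih =>
      intro u hu hmem
      have hlk : l ^ (k + 1) ≤ 1 := pow_le_one₀ hl0.le hl1.le
      have hdist : dist (p + l ^ (k + 1) • u) p < r := by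
        rw [dist_self_add_left, norm_smul, Real.norm_of_nonneg (by positivity)]
        exact (mul_le_of_le_one_left (norm_nonneg _) hlk).trans_lt hu
      obtain ⟨y, hy, hfy⟩ := hball hdist hmem
      have hy' : y = p + l ^ k • A.symm u := by
        apply f.injective
        rw [hfy, hA, hfp, map_smul, A.apply_symm_apply, smul_smul, pow_succ']
      rw [Function.iterate_succ_apply]
      exact ih _ (by rwa [A.symm.norm_map]) (hy' ▸ hy)
  refine ⟨r, hr, fun v hv c hc0 hcv => ?_⟩
  rw [← hK.closure_eq, Metric.mem_closure_iff]
  intro ε hε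
  have hlim : Tendsto (fun n : ℕ => l ^ n * c) atTop (𝓝 0) := by
    simpa using (tendsto_pow_atTop_nhds_zero_of_lt_one hl0.le hl1).mul_const c
  obtain ⟨N, hN⟩ := eventually_atTop.1 (hlim.eventually (gt_mem_nhds zero_lt_one))
  obtain ⟨k, hk, hdist⟩ := A.symm.exists_norm_iterate_sub_lt (c • v) N hε
  refine ⟨_, hexp k (c • v) hcv ?_, by rwa [dist_add_left, dist_comm]⟩
  have h1 := hc.add_smul_sub_mem hp hv (t := l ^ k * c) ⟨by positivity, (hN k hk).le⟩
  rwa [add_sub_cancel_left, ← smul_smul] at h1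

end Similarity

/-! ### Dual slices of convex cones -/

section Cone

variable {E : Type*} [NormedAddCommGroup E] [InnerProductSpace ℝ E]

/-- A compact convex set contained in a line is a segment. -/
theorem IsCompact.exists_segment_eq {D : Set E} (hD : IsCompact D) (hc : Convex ℝ D)
    (hne : D.Nonempty) (u : E) (hu : ∀ a ∈ D, ∀ b ∈ D, ∃ c : ℝ, c • u = a - b) :
    ∃ a ∈ D, ∃ b ∈ D, segment ℝ a b = D := by
  have hcont : Continuous fun x : E => inner ℝ u x := by fun_prop
  obtain ⟨a, ha, hmin⟩ := hD.exists_isMinOn hne hcont.continuousOn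
  obtain ⟨b, hb, hmax⟩ := hD.exists_isMaxOn hne hcont.continuousOn
  refine ⟨a, ha, b, hb, Subset.antisymm (hc.segment_subset ha hb) fun d hd => ?_⟩
  obtain ⟨s, hs⟩ := hu d hd a ha
  obtain ⟨t, ht⟩ := hu b hb a ha
  obtain rfl : d = a + s • u := by rw [hs]; abel
  obtain rfl : b = a + t • u := by rw [ht]; abel
  rcases eq_or_ne u 0 with rfl | hu0
  · simp
  have hpos : 0 < inner ℝ u u := real_inner_self_pos.2 hu0
  have h1 : inner ℝ u a ≤ inner ℝ u (a + s • u) := hmin hd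
  have h2 : inner ℝ u (a + s • u) ≤ inner ℝ u (a + t • u) := hmax hd
  simp only [inner_add_right, real_inner_smul_right] at h1 h2
  have hs0 : 0 ≤ s := by
    by_contra! h
    nlinarith
  have hst : s ≤ t := by
    by_contra! h
    nlinarith
  rw [segment_eq_image']
  rcases hs0.eq_or_lt with h0 | h0
  · exact ⟨0, by simp, by simp [← h0]⟩
  · have ht0 : 0 < t := h0.trans_le hst
    refine ⟨s / t, ⟨by positivity, (div_le_one ht0).2 hst⟩, ?_⟩
    simp only [add_sub_cancel_left, smul_smul, div_mul_cancel₀ _ ht0.ne']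

/-- A slice of the dual of the cone spanned by `K - p`. -/
def dualSlice (K : Set E) (p e : E) : Set E :=
  {a | inner ℝ a e = 1 ∧ ∀ y ∈ K, 0 ≤ inner ℝ a (y - p)}

theorem convex_dualSlice (K : Set E) (p e : E) : Convex ℝ (dualSlice K p e) := by
  rintro a ⟨ha, ha'⟩ b ⟨hb, hb'⟩ s t hs ht hst
  refine ⟨?_, fun y hy => ?_⟩
  · simp [inner_add_left, real_inner_smul_left, ha, hb, hst]
  · simp only [inner_add_left, real_inner_smul_left]
    exact add_nonneg (mul_nonneg hs (ha' y hy)) (mul_nonneg ht (hb' y hy))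

theorem isClosed_dualSlice (K : Set E) (p e : E) : IsClosed (dualSlice K p e) := by
  have : dualSlice K p e = {a : E | inner ℝ a e = 1} ∩ ⋂ y ∈ K, {a : E | 0 ≤ inner ℝ a (y - p)} := by
    ext a
    simp [dualSlice]
  rw [this]
  refine (isClosed_eq (by fun_prop) continuous_const).inter (isClosed_biInter fun y _ => ?_)
  exact isClosed_le continuous_const (by fun_prop)

/-- Testing `a` on the point `p + e - (δ / ‖a‖) • a` of `K` gives `‖a‖ ≤ 1 / δ`. -/
theorem isCompact_dualSlice [FiniteDimensional ℝ E] {K : Set E} {p e : E}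
    (he : p + e ∈ interior K) : IsCompact (dualSlice K p e) := by
  have : ProperSpace E := FiniteDimensional.proper_real E
  obtain ⟨δ, hδ, hball⟩ := Metric.nhds_basis_closedBall.mem_iff.1 (mem_interior_iff_mem_nhds.1 he)
  refine (isCompact_closedBall (0 : E) (1 / δ)).of_isClosed_subset (isClosed_dualSlice K p e) ?_
  rintro a ⟨ha, ha'⟩
  rcases eq_or_ne a 0 with rfl | ha0
  · simp [hδ.le]
  have hn : 0 < ‖a‖ := norm_pos_iff.2 ha0
  have h := ha' (p + e - (δ / ‖a‖) • a) (hball (by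
    rw [mem_closedBall, dist_self_sub_left, norm_smul, Real.norm_of_nonneg (by positivity),
      div_mul_cancel₀ _ hn.ne']))
  have h1 : p + e - (δ / ‖a‖) • a - p = e - (δ / ‖a‖) • a := by abel
  rw [h1, inner_sub_right, ha, real_inner_smul_right, real_inner_self_eq_norm_sq] at h
  rw [mem_closedBall_zero_iff, le_div_iff₀ hδ]
  have h2 : δ / ‖a‖ * ‖a‖ ^ 2 = ‖a‖ * δ := by field_simp
  linarith

/-- Near the apex, the points outside of a conical convex set are separated from it by hyperplanes
through the apex. -/
theorem IsConicalAt.exists_mem_dualSlice [CompleteSpace E] {K : Set E} {p e : E}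
    (h : IsConicalAt K p) (hK : IsClosed K) (hc : Convex ℝ K) (hp : p ∈ K)
    (he : p + e ∈ interior K) :
    ∀ᶠ y in 𝓝 p, y ∉ K → ∃ a ∈ dualSlice K p e, inner ℝ a (y - p) < 0 := by
  obtain ⟨r, hr, hcon⟩ := h
  filter_upwards [ball_mem_nhds p hr] with y hy hyK
  obtain ⟨v, rfl⟩ : ∃ v, y = p + v := ⟨y - p, by abel⟩
  have hv : ‖v‖ < r := by simpa using hy
  -- The cone spanned by `K - p`. Conicality makes it closed, so `v` can be strictly separated from
  -- it.
  set C : Set E := {w | ∃ t : ℝ, 0 < t ∧ p + t • w ∈ K} with hC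
  have hscale : ∀ w ∈ C, ∀ s : ℝ, 0 ≤ s → ‖s • w‖ < r → p + s • w ∈ K := by
    rintro w ⟨t, ht, hw⟩ s hs hsw
    have := hcon _ hw (s / t) (by positivity) (by rwa [smul_smul, div_mul_cancel₀ _ ht.ne'])
    rwa [smul_smul, div_mul_cancel₀ _ ht.ne'] at this
  have hsmall : ∀ w : E, ∀ᶠ s : ℝ in 𝓝[>] 0, ‖s • w‖ < r := fun w => by
    have hcont : Continuous fun s : ℝ => ‖s • w‖ := by fun_prop
    exact nhdsWithin_le_nhds ((hcont.tendsto 0).eventually (gt_mem_nhds (by simpa using hr)))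
  have hCsmul : ∀ w ∈ C, ∀ s : ℝ, 0 < s → s • w ∈ C := by
    rintro w ⟨t, ht, hw⟩ s hs
    exact ⟨t / s, by positivity, by rwa [smul_smul, div_mul_cancel₀ _ hs.ne']⟩
  have hCconv : Convex ℝ C := by
    intro a ha b hb s t hs ht hst
    obtain ⟨ε, ⟨h1, h2⟩, hε⟩ := (((hsmall a).and (hsmall b)).and self_mem_nhdsWithin).exists
    have hε : 0 < ε := hε
    refine ⟨ε, hε, ?_⟩
    have h3 := hc (hscale a ha ε hε.le h1) (hscale b hb ε hε.le h2) hs ht hst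
    have h4 : s • (p + ε • a) + t • (p + ε • b) = (s + t) • p + ε • (s • a + t • b) := by module
    rwa [h4, hst, one_smul] at h3
  have hCclosed : IsClosed C := by
    refine isClosed_of_closure_subset fun w hw => ?_
    obtain ⟨ε, h1, hε⟩ := ((hsmall w).and self_mem_nhdsWithin).exists
    have hε : 0 < ε := hε
    have hcont : Continuous fun x : E => p + ε • x := by fun_prop
    refine ⟨ε, hε, ?_⟩
    have hlt : ∀ᶠ x in 𝓝 w, ‖ε • x‖ < r := by
      have hn : Continuous fun x : E => ‖ε • x‖ := by fun_prop
      exact (hn.tendsto w).eventually (gt_mem_nhds h1)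
    have hfreq := (mem_closure_iff_frequently.1 hw).and_eventually hlt
    exact (hK.preimage hcont).mem_of_frequently_of_tendsto
      (hfreq.mono fun x hx => hscale x hx.1 ε hε.le hx.2) tendsto_id
  have hvC : v ∉ C := fun hvC => hyK (by simpa using hscale v hvC 1 zero_le_one (by simpa using hv))
  obtain ⟨φ, u, hu, hφ⟩ := geometric_hahn_banach_point_closed hCconv hCclosed hvC
  have hu0 : u < 0 := by
    simpa using hφ 0 ⟨1, one_pos, by simpa using hp⟩
  have hφC : ∀ w ∈ C, 0 ≤ φ w := by
    intro w hw
    by_contra! hneg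
    have := hφ _ (hCsmul w hw (u / φ w) (div_pos_of_neg_of_neg hu0 hneg))
    rw [map_smul, smul_eq_mul, div_mul_cancel₀ _ hneg.ne] at this
    exact lt_irrefl _ this
  have hφv : φ v < 0 := hu.trans hu0
  -- As `e + t • v` is in `C` for small `t > 0` while `φ v < 0`, positivity is strict and `φ` can be
  -- normalised into the slice.
  have hφe : 0 < φ e := by
    have hcont : Continuous fun t : ℝ => p + (e + t • v) := by fun_prop
    have hev : ∀ᶠ t : ℝ in 𝓝[>] 0, p + (e + t • v) ∈ K :=
      nhdsWithin_le_nhds ((hcont.tendsto 0).eventually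
        (by simpa using mem_interior_iff_mem_nhds.1 he))
    obtain ⟨t, ht, ht0⟩ := (hev.and self_mem_nhdsWithin).exists
    have ht0 : 0 < t := ht0
    have := hφC (e + t • v) ⟨1, one_pos, by rwa [one_smul]⟩
    rw [map_add, map_smul, smul_eq_mul] at this
    nlinarith
  refine ⟨(φ e)⁻¹ • (InnerProductSpace.toDual ℝ E).symm φ, ⟨?_, fun y hy => ?_⟩, ?_⟩
  · rw [real_inner_smul_left, InnerProductSpace.toDual_symm_apply, inv_mul_cancel₀ hφe.ne']
  · rw [real_inner_smul_left, InnerProductSpace.toDual_symm_apply]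
    exact mul_nonneg (inv_nonneg.2 hφe.le) (hφC _ ⟨1, one_pos, by simpa using hy⟩)
  · rw [add_sub_cancel_left, real_inner_smul_left, InnerProductSpace.toDual_symm_apply]
    exact mul_neg_of_pos_of_neg (inv_pos.2 hφe) hφv

/-- A conical convex set whose dual cone is at most two-dimensional is locally polyhedral at the
apex. -/
theorem IsConicalAt.isLocallyPolyhedralAt [FiniteDimensional ℝ E] {K : Set E} {p e : E}
    (h : IsConicalAt K p) (hK : IsClosed K) (hc : Convex ℝ K) (hp : p ∈ K)
    (he : p + e ∈ interior K) (u : E)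
    (hu : ∀ a ∈ dualSlice K p e, ∀ b ∈ dualSlice K p e, ∃ c : ℝ, c • u = a - b) :
    IsLocallyPolyhedralAt K p := by
  have : CompleteSpace E := FiniteDimensional.complete ℝ E
  have hsep := h.exists_mem_dualSlice hK hc hp he
  rcases (dualSlice K p e).eq_empty_or_nonempty with hD | hD
  · refine ⟨univ, isPolyhedron_univ, hsep.mono fun y hy => ?_⟩
    simpa [hD] using hy
  obtain ⟨a, ha, b, hb, hab⟩ := (isCompact_dualSlice he).exists_segment_eq
    (convex_dualSlice K p e) hD u hu
  -- The endpoints of the slice suffice, every other constraint being a convex combination of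
  -- theirs.
  refine ⟨_, ⟨{(-innerSL ℝ a, -inner ℝ a p), (-innerSL ℝ b, -inner ℝ b p)}, by simp, rfl⟩, ?_⟩
  filter_upwards [hsep] with y hy
  simp only [mem_insert_iff, mem_singleton_iff, forall_eq_or_imp, forall_eq,
    neg_apply, innerSL_apply_apply, neg_le_neg_iff]
  constructor
  · intro hyK
    have h1 := ha.2 y hyK
    have h2 := hb.2 y hyK
    rw [inner_sub_right] at h1 h2
    exact ⟨by linarith, by linarith⟩
  · rintro ⟨h1, h2⟩
    by_contra hyK
    obtain ⟨d, hd, hneg⟩ := hy hyK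
    rw [← hab] at hd
    obtain ⟨s, t, hs, ht, -, rfl⟩ := hd
    rw [inner_add_left, real_inner_smul_left, real_inner_smul_left, inner_sub_right,
      inner_sub_right] at hneg
    nlinarith [mul_nonneg hs (sub_nonneg.2 h1), mul_nonneg ht (sub_nonneg.2 h2)]

/-- The orthogonal complement of a subspace of codimension at most one lies on a line. -/
theorem Submodule.exists_forall_mem_orthogonal [FiniteDimensional ℝ E] (V : Submodule ℝ E)
    (hV : Module.finrank ℝ E ≤ Module.finrank ℝ V + 1) :
    ∃ u : E, ∀ w ∈ Vᗮ, ∃ c : ℝ, c • u = w := by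
  have h1 := V.finrank_add_finrank_orthogonal
  obtain ⟨u, hu⟩ := finrank_le_one_iff.1 (show Module.finrank ℝ Vᗮ ≤ 1 by omega)
  refine ⟨u, fun w hw => ?_⟩
  obtain ⟨c, hc⟩ := hu ⟨w, hw⟩
  exact ⟨c, congrArg Subtype.val hc⟩

theorem IsConvexBody.exists_add_mem_interior {K : Set E} (hK : IsConvexBody K) (p : E) :
    ∃ e, p + e ∈ interior K := by
  obtain ⟨y, hy⟩ := hK.interior_nonempty
  exact ⟨y - p, by simpa using hy⟩

variable [FiniteDimensional ℝ E] {K : Set E} {p : E}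

/-- In the plane, a convex body is locally polyhedral at every point where it is conical. -/
theorem IsConicalAt.isLocallyPolyhedralAt_of_finrank_le_two (hE : Module.finrank ℝ E ≤ 2)
    (h : IsConicalAt K p) (hK : IsConvexBody K) (hp : p ∈ K) : IsLocallyPolyhedralAt K p := by
  obtain ⟨e, he⟩ := hK.exists_add_mem_interior p
  rcases eq_or_ne e 0 with rfl | he0
  · refine h.isLocallyPolyhedralAt hK.isCompact.isClosed hK.convex hp he 0 fun a ha => ?_
    simpa using ha.1
  obtain ⟨u, hu⟩ := Submodule.exists_forall_mem_orthogonal (ℝ ∙ e)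
    (by rw [finrank_span_singleton he0]; exact hE)
  refine h.isLocallyPolyhedralAt hK.isCompact.isClosed hK.convex hp he u fun a ha b hb => ?_
  refine hu _ (Submodule.mem_orthogonal_singleton_iff_inner_left.2 ?_)
  rw [inner_sub_left, ha.1, hb.1, sub_self]

/-- In three-dimensional space, a convex body is locally polyhedral at a point `p` where it is
conical if it contains a segment with `p` in its relative interior. -/
theorem IsConicalAt.isLocallyPolyhedralAt_of_finrank_le_three (hE : Module.finrank ℝ E ≤ 3)
    (h : IsConicalAt K p) (hK : IsConvexBody K) (hp : p ∈ K) {v : E} (hv : v ≠ 0)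
    (h1 : p + v ∈ K) (h2 : p - v ∈ K) : IsLocallyPolyhedralAt K p := by
  obtain ⟨e, he⟩ := hK.exists_add_mem_interior p
  have hav : ∀ a ∈ dualSlice K p e, inner ℝ a v = 0 := by
    intro a ha
    have h3 := ha.2 _ h1
    have h4 := ha.2 _ h2
    rw [add_sub_cancel_left] at h3
    rw [sub_sub_cancel_left, inner_neg_right] at h4
    linarith
  by_cases hlin : LinearIndependent ℝ ![e, v]
  · obtain ⟨u, hu⟩ := Submodule.exists_forall_mem_orthogonal (Submodule.span ℝ (range ![e, v]))
      (by rw [finrank_span_eq_card hlin]; simpa using hE)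
    refine h.isLocallyPolyhedralAt hK.isCompact.isClosed hK.convex hp he u fun a ha b hb => ?_
    refine hu _ ((Submodule.mem_orthogonal' _ _).2 fun w hw => ?_)
    rw [Matrix.range_cons_cons_empty, Submodule.mem_span_pair] at hw
    obtain ⟨s, t, rfl⟩ := hw
    simp [inner_sub_left, inner_add_right, real_inner_smul_right, ha.1, hb.1, hav a ha, hav b hb]
  -- If `e` is a multiple of `v`, the slice is empty, since its elements vanish on `v` but not on
  -- `e`.
  · refine h.isLocallyPolyhedralAt hK.isCompact.isClosed hK.convex hp he 0 fun a ha => ?_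
    exfalso
    refine hlin (LinearIndependent.pair_symm_iff.1
      ((LinearIndependent.pair_iff' hv).2 fun c hc => ?_))
    have := ha.1
    rw [← hc, real_inner_smul_right, hav a ha, mul_zero] at this
    exact zero_ne_one this

end Cone

/-! ### Bodies with similar pieces cut out -/

section SimilarCuts

variable {E : Type*} [NormedAddCommGroup E] [InnerProductSpace ℝ E] [FiniteDimensional ℝ E]
  {K : Set E}

/-- A convex body of dimension at most one is a polytope. -/
theorem IsConvexBody.isPolytope_of_finrank_le_one (hE : Module.finrank ℝ E ≤ 1)
    (hK : IsConvexBody K) : IsPolytope K := by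
  obtain ⟨u, hu⟩ := finrank_le_one_iff.1 hE
  obtain ⟨a, -, b, -, hab⟩ := hK.isCompact.exists_segment_eq hK.convex
    (hK.interior_nonempty.mono interior_subset) u fun a _ b _ => hu (a - b)
  exact ⟨{a, b}, by simp, by rw [convexHull_pair, hab]⟩

/-- In the plane, a convex body from which a smaller similar copy can be cut out by half-spaces is
locally polyhedral. -/
theorem isLocallyPolyhedralAt_of_isCut_image (hE : Module.finrank ℝ E ≤ 2) (hK : IsConvexBody K)
    {f : E ≃ᵈ E} (hf : Dilation.ratio f < 1) (hcut : IsCut (f '' K) K) :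
    ∀ x ∈ K, IsLocallyPolyhedralAt K x := by
  have : CompleteSpace E := FiniteDimensional.complete ℝ E
  have hcl := hK.isCompact.isClosed
  by_contra! hS
  obtain ⟨p, hp, hpS, hfp⟩ := exists_fixedPoint_not_isLocallyPolyhedralAt hcl hf hcut hS
  exact hpS ((hcut.isConicalAt hcl hK.convex hf hp hfp).isLocallyPolyhedralAt_of_finrank_le_two
    hE hK hp)

/-- If `f '' K` and `g '' K` are cut out of the convex body `K` by half-spaces and have disjoint
interiors, then `f` and `g` have no common fixed point in `K`. -/
theorem IsCut.fixedPoint_ne {f g : E ≃ᵈ E} (hK : IsConvexBody K) (hf : IsCut (f '' K) K)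
    (hg : IsCut (g '' K) K) (hfg : Disjoint (interior (f '' K)) (interior (g '' K))) {p : E}
    (hp : p ∈ K) (hfp : f p = p) : g p ≠ p := by
  intro hgp
  have hpc : p ∈ closure (interior K) := by
    rw [hK.convex.closure_interior_eq_closure_of_nonempty_interior hK.interior_nonempty]
    exact subset_closure hp
  -- At a common fixed point both images agree with `K` nearby, so an interior point of `K` close to
  -- `p` is interior to both.
  obtain ⟨z, hzK, hz1, hz2⟩ := ((mem_closure_iff_frequently.1 hpc).and_eventually
    ((eventually_eventually_nhds.2 (hf.eventually_mem_image hp hfp)).and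
      (eventually_eventually_nhds.2 (hg.eventually_mem_image hp hgp)))).exists
  have hzn := mem_interior_iff_mem_nhds.1 hzK
  have hzf : z ∈ interior (f '' K) ∧ z ∈ interior (g '' K) := by
    refine ⟨mem_interior_iff_mem_nhds.2 ?_, mem_interior_iff_mem_nhds.2 ?_⟩
    · filter_upwards [hz1, hzn] with y h1 h2 using h1 h2
    · filter_upwards [hz2, hzn] with y h1 h2 using h1 h2
  exact hfg.le_bot hzf

/-- In three-dimensional space, a convex body from which two smaller similar copies with disjoint
interiors can be cut out by half-spaces is locally polyhedral. -/
theorem isLocallyPolyhedralAt_of_isCut_image_of_isCut_image (hE : Module.finrank ℝ E ≤ 3)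
    (hK : IsConvexBody K) {f g : E ≃ᵈ E} (hf : Dilation.ratio f < 1) (hg : Dilation.ratio g < 1)
    (hfcut : IsCut (f '' K) K) (hgcut : IsCut (g '' K) K)
    (hfg : Disjoint (interior (f '' K)) (interior (g '' K))) :
    ∀ x ∈ K, IsLocallyPolyhedralAt K x := by
  have : CompleteSpace E := FiniteDimensional.complete ℝ E
  have hcl := hK.isCompact.isClosed
  by_contra! hS
  obtain ⟨p, hp, -, hfp⟩ := exists_fixedPoint_not_isLocallyPolyhedralAt hcl hf hfcut hS
  obtain ⟨r, hr, hcon⟩ := hfcut.isConicalAt hcl hK.convex hf hp hfp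
  obtain ⟨R, hR⟩ := isBounded_iff.1 hK.isCompact.isBounded
  have hlim : Tendsto (fun k : ℕ => (Dilation.ratio f : ℝ) ^ k * R) atTop (𝓝 0) := by
    simpa using (tendsto_pow_atTop_nhds_zero_of_lt_one (NNReal.coe_nonneg _)
      (by exact_mod_cast hf)).mul_const R
  -- This `k` makes `f ^ k` map all of `K` into the ball around `p` where `K` is conical.
  obtain ⟨k, hk⟩ := (hlim.eventually (gt_mem_nhds hr)).exists
  have hfk : (f ^ k : E ≃ᵈ E) p = p := by
    rw [DilationEquiv.coe_pow]
    exact Function.iterate_fixed hfp k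
  have hw : Dilation.ratio (f ^ k * g : E ≃ᵈ E) < 1 := by
    rw [DilationEquiv.mul_def, DilationEquiv.ratio_trans, DilationEquiv.ratio_pow]
    exact mul_lt_one_of_nonneg_of_lt_one_left zero_le hg (pow_le_one₀ zero_le hf.le)
  have hwcut : IsCut ((f ^ k * g : E ≃ᵈ E) '' K) K := by
    rw [DilationEquiv.coe_mul, image_comp]
    exact (hgcut.image _).trans (hfcut.iterate_image k)
  obtain ⟨x, hx, hxS, hwx⟩ := exists_fixedPoint_not_isLocallyPolyhedralAt hcl hw hwcut hS
  rw [DilationEquiv.mul_def] at hwx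
  have hwx' : (f ^ k : E ≃ᵈ E) (g x) = x := hwx
  have hxp : x - p ≠ 0 := by
    intro h0
    obtain rfl : x = p := sub_eq_zero.1 h0
    exact hfcut.fixedPoint_ne hK hgcut hfg hp hfp
      ((f ^ k : E ≃ᵈ E).injective (hwx'.trans hfk.symm))
  have hdist : ‖x - p‖ < r := by
    rw [← dist_eq_norm]
    calc dist x p = dist ((f ^ k : E ≃ᵈ E) (g x)) ((f ^ k : E ≃ᵈ E) p) := by rw [hwx', hfk]
      _ = (Dilation.ratio f : ℝ) ^ k * dist (g x) p := by
        rw [Dilation.dist_eq, DilationEquiv.ratio_pow, NNReal.coe_pow]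
      _ ≤ (Dilation.ratio f : ℝ) ^ k * R := by
        gcongr
        exact hR (hgcut.subset ⟨x, hx, rfl⟩) hp
      _ < r := hk
  -- The segment through `x`: conicality at `p` extends the ray beyond `x`, and convexity gives the
  -- part towards `p`.
  have hev : ∀ᶠ c : ℝ in 𝓝[>] 0, ‖(1 + c) • (x - p)‖ < r := by
    have hcont : Continuous fun c : ℝ => ‖(1 + c) • (x - p)‖ := by fun_prop
    exact nhdsWithin_le_nhds ((hcont.tendsto 0).eventually (gt_mem_nhds (by simpa using hdist)))
  obtain ⟨c, hc, hc0, hc1⟩ :=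
    (hev.and (Ioo_mem_nhdsGT (zero_lt_one : (0 : ℝ) < 1))).exists
  have hxK : p + (x - p) ∈ K := by simpa using hx
  have h1 := hcon _ hxK (1 + c) (by linarith) hc
  have h2 := hK.convex.add_smul_sub_mem hp hx (t := 1 - c) ⟨by linarith, by linarith⟩
  rw [show p + (1 + c) • (x - p) = x + c • (x - p) by module] at h1
  rw [show p + (1 - c) • (x - p) = x - c • (x - p) by module] at h2
  exact hxS ((hwcut.isConicalAt hcl hK.convex hw hx hwx).isLocallyPolyhedralAt_of_finrank_le_three
    hE hK hx (smul_ne_zero hc0.ne' hxp) h1 h2)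

end SimilarCuts

/-! ### The theorem, by dimension -/

theorem mainTheorem3 (n : ℕ) (hn : n ≤ 3) (K : Set (EuclideanSpace ℝ (Fin n)))
    (hK : IsConvexBody K) (T : Set (Set (EuclideanSpace ℝ (Fin n))))
    (hT : IsProperTiling K T)
    (hsim : n - 1 ≤ {L ∈ T | IsSimilarTo L K}.ncard) :
    IsPolytope K := by
  have hfin : {L ∈ T | IsSimilarTo L K}.Finite := hT.finite.subset (sep_subset _ _)
  have htile : ∀ L ∈ {L ∈ T | IsSimilarTo L K}, ∃ f : EuclideanSpace ℝ (Fin n) ≃ᵈ _,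
      f '' K = L ∧ Dilation.ratio f < 1 ∧ IsCut (f '' K) K := by
    rintro _ ⟨hL, f, rfl⟩
    have hcut := hT.isCut hK.convex hL
    exact ⟨f, rfl, hK.isCompact.ratio_lt_one hcut.subset (hT.ne hL), hcut⟩
  have hdim : Module.finrank ℝ (EuclideanSpace ℝ (Fin n)) = n := finrank_euclideanSpace_fin
  rcases Nat.lt_or_ge n 2 with h1 | h2
  · exact hK.isPolytope_of_finrank_le_one (by omega)
  refine isPolytope_of_isLocallyPolyhedralAt hK.isCompact hK.convex ?_
  rcases h2.eq_or_lt with h2 | h2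
  · obtain ⟨L, hL⟩ := (ncard_pos hfin).1 (by omega : 0 < {L ∈ T | IsSimilarTo L K}.ncard)
    obtain ⟨f, -, hf, hcut⟩ := htile L hL
    exact isLocallyPolyhedralAt_of_isCut_image (by omega) hK hf hcut
  · obtain ⟨L, hL, M, hM, hLM⟩ :=
      (one_lt_ncard hfin).1 (by omega : 1 < {L ∈ T | IsSimilarTo L K}.ncard)
    obtain ⟨f, rfl, hf, hfcut⟩ := htile L hL
    obtain ⟨g, rfl, hg, hgcut⟩ := htile M hM
    exact isLocallyPolyhedralAt_of_isCut_image_of_isCut_image (by omega) hK hf hg hfcut hgcut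
      (hT.disjoint_interior _ hL.1 _ hM.1 hLM)
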